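/- Let $\mathcal H$ be a complex Hilbert space, let $n\ge 1$, and let $\mathbb F_n^+$ be the unital free semigroup on $g_1,\dots,g_n$ with identity $g_0$ and word length $|\alpha|$. For a Hilbert space $\mathcal X$ put $$[B(\mathcal X)^n]_{<1}:=\{(X_1,\dots,X_n)\in B(\mathcal X)^n:\ \|X_1X_1^*+\cdots+X_nX_n^*\|<1\},$$ and write $X_\alpha:=X_{i_1}\cdots X_{i_k}$ if $\alpha=g_{i_1}\cdots g_{i_k}$, $X_{g_0}:=I$. Let $\mathcal A=\{A_{(\alpha)}\}_{\alpha\in\mathbb F_n^+}$ and $\mathcal B=\{B_{(\alpha)}\}_{\alpha\in\mathbb F_n^+}$ be families in $B(\mathcal H)$, and write $A_{(0)}:=A_{(g_0)}$, $B_{(0)}:=B_{(g_0)}$. Assume that $A_{(0)}$ and $B_{(0)}$ are selfadjoint and that the series $$F_{\mathcal A}(X_1,\dots,X_n)=\tfrac12 I\otimes A_{(0)}+\sum_{k=1}^\infty\sum_{|\alpha|=k}X_\alpha\otimes A_{(\alpha)}$$ and the analogous series $F_{\mathcal B}$ converge in the operator norm of $B(\mathcal X\otimes\mathcal H)$ for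 every Hilbert space $\mathcal X$ and every $(X_1,\dots,X_n)\in[B(\mathcal X)^n]_{<1}$. Let $H_{\mathcal A}:=\operatorname{Re}F_{\mathcal A}=\frac12(F_{\mathcal A}+F_{\mathcal A}^*)$ and $H_{\mathcal B}:=\operatorname{Re}F_{\mathcal B}$ be the corresponding noncommutative harmonic functions, and suppose that $$H_{\mathcal A}(X_1,\dots,X_n)\le H_{\mathcal B}(X_1,\dots,X_n)$$ for every Hilbert space $\mathcal X$ and every $(X_1,\dots,X_n)\in[B(\mathcal X)^n]_{<1}$. Then $$\sum_{|\alpha|=k}(B_{(\alpha)}-A_{(\alpha)})^*(B_{(\alpha)}-A_{(\alpha)})\le\|B_{(0)}-A_{(0)}\|\,(B_{(0)}-A_{(0)})\qquad(k=1,2,\dots),$$ and for every $r\in[0,\frac13]$ both series below converge and $$\sum_{k=1}^\infty r^k\Big\|\sum_{|\alpha|=k}A_{(\alpha)}^*A_{(\alpha)}\Big\|^{1/2}\le\tfrac12\|B_{(0)}-A_{(0)}\|+\sum_{k=1}^\infty r^k\Big\|\sum_{|\alpha|=k}B_{(\alpha)}^*B_{(\alpha)}\Big\|^{1/2}.$$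 -/

import Mathlib

universe u v

noncomputable section

namespace NCHarmonic

open Filter Topology
open scoped TensorProduct ComplexStarModule

/-- The words of length `k` in the unital free semigroup on `n` generators. -/
def words (n k : ℕ) : Finset (FreeMonoid (Fin n)) :=
  Finset.univ.map
    ⟨fun w : Fin k → Fin n => FreeMonoid.ofList (List.ofFn w),
      fun _ _ h => List.ofFn_injective (FreeMonoid.ofList.injective h)⟩

theorem mem_words {n k : ℕ} {α : FreeMonoid (Fin n)} : α ∈ words n k ↔ α.length = k := by
  simp only [words, Finset.mem_map, Finset.mem_univ, true_and]
  constructor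
  · rintro ⟨w, rfl⟩
    exact List.length_ofFn
  · rintro rfl
    exact ⟨fun i => (FreeMonoid.toList α).get i, List.ofFn_get (FreeMonoid.toList α)⟩

/-- The monomial `X_α = X_{i₁} X_{i₂} ⋯ X_{iₖ}` for `α = g_{i₁} g_{i₂} ⋯ g_{iₖ}`, with the
identity for the empty word. -/
def monomial {n : ℕ} {X : Type*} [NormedAddCommGroup X] [InnerProductSpace ℂ X]
    (T : Fin n → X →L[ℂ] X) (α : FreeMonoid (Fin n)) : X →L[ℂ] X :=
  FreeMonoid.lift T α

/-- The open unit ball of `B(X)ⁿ`: the tuples with `‖X₁X₁* + ⋯ + XₙXₙ*‖ < 1`. -/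
def rowBall (n : ℕ) (X : Type*) [NormedAddCommGroup X] [InnerProductSpace ℂ X]
    [CompleteSpace X] : Set (Fin n → X →L[ℂ] X) :=
  {T | ‖∑ i, T i * ContinuousLinearMap.adjoint (T i)‖ < 1}

/-- The Hilbert space tensor product: the completion of the algebraic tensor product in the
norm of the inner product `⟪x ⊗ h, x' ⊗ h'⟫ = ⟪x, x'⟫ ⟪h, h'⟫`. -/
abbrev HilbertTensor (X H : Type*) [NormedAddCommGroup X] [InnerProductSpace ℂ X]
    [NormedAddCommGroup H] [InnerProductSpace ℂ H] : Type _ :=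
  UniformSpace.Completion (X ⊗[ℂ] H)

/-- The operator `S ⊗ A` on the Hilbert space tensor product. -/
def opTensor {X H : Type*} [NormedAddCommGroup X] [InnerProductSpace ℂ X]
    [NormedAddCommGroup H] [InnerProductSpace ℂ H] (S : X →L[ℂ] X) (A : H →L[ℂ] H) :
    HilbertTensor X H →L[ℂ] HilbertTensor X H :=
  (TensorProduct.mapL S A).completion

theorem opTensor_coe_tmul {X H : Type*} [NormedAddCommGroup X] [InnerProductSpace ℂ X]
    [NormedAddCommGroup H] [InnerProductSpace ℂ H] (S : X →L[ℂ] X) (A : H →L[ℂ] H)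
    (x : X) (h : H) :
    opTensor S A ((x ⊗ₜ[ℂ] h : X ⊗[ℂ] H) : HilbertTensor X H)
      = ((S x ⊗ₜ[ℂ] A h : X ⊗[ℂ] H) : HilbertTensor X H) :=
  UniformSpace.Completion.map_coe (TensorProduct.mapL S A).uniformContinuous _

/-- The partial sum `∑_{k < N} ∑_{|α| = k} X_α ⊗ C_α`. -/
def partialSum {n : ℕ} {X H : Type*} [NormedAddCommGroup X] [InnerProductSpace ℂ X]
    [NormedAddCommGroup H] [InnerProductSpace ℂ H]
    (C : FreeMonoid (Fin n) → H →L[ℂ] H) (T : Fin n → X →L[ℂ] X) (N : ℕ) :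
    HilbertTensor X H →L[ℂ] HilbertTensor X H :=
  ∑ k ∈ Finset.range N, ∑ α ∈ words n k, opTensor (monomial T α) (C α)

/-- The coefficients `C` generate a (universal) holomorphic function on the unit ball: for every
Hilbert space `X` (of the universe `v`) and every tuple in the open unit ball of `B(X)ⁿ`, the
series `∑ₖ ∑_{|α| = k} X_α ⊗ C_α` converges in the operator norm. -/
def IsHolomorphic {n : ℕ} {H : Type u} [NormedAddCommGroup H] [InnerProductSpace ℂ H]
    (C : FreeMonoid (Fin n) → H →L[ℂ] H) : Prop :=
  ∀ (X : Type v) [NormedAddCommGroup X] [InnerProductSpace ℂ X] [CompleteSpace X],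
    ∀ T ∈ rowBall n X, ∃ L : HilbertTensor X H →L[ℂ] HilbertTensor X H,
      Tendsto (partialSum C T) atTop (𝓝 L)

/-- The value `∑ₖ ∑_{|α| = k} X_α ⊗ C_α`, as the limit of the partial sums in operator norm. -/
def eval {n : ℕ} {X H : Type*} [NormedAddCommGroup X] [InnerProductSpace ℂ X]
    [NormedAddCommGroup H] [InnerProductSpace ℂ H]
    (C : FreeMonoid (Fin n) → H →L[ℂ] H) (T : Fin n → X →L[ℂ] X) :
    HilbertTensor X H →L[ℂ] HilbertTensor X H :=
  limUnder atTop (partialSum C T)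

/-- The coefficients of `F(X) = ½ I ⊗ A₀ + ∑_{k ≥ 1} ∑_{|α| = k} X_α ⊗ A_α`. -/
def halved {n : ℕ} {H : Type*} [NormedAddCommGroup H] [InnerProductSpace ℂ H]
    (A : FreeMonoid (Fin n) → H →L[ℂ] H) (α : FreeMonoid (Fin n)) : H →L[ℂ] H :=
  if α.length = 0 then (1 / 2 : ℂ) • A α else A α

/-- `A` is a family of coefficients of a selfadjoint noncommutative harmonic function: `A₀` is
selfadjoint and `½ I ⊗ A₀ + ∑_{k ≥ 1} ∑_{|α| = k} X_α ⊗ A_α` is holomorphic on the unit ball. -/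
structure IsHarmonicFamily {n : ℕ} {H : Type u} [NormedAddCommGroup H] [InnerProductSpace ℂ H]
    [CompleteSpace H] (A : FreeMonoid (Fin n) → H →L[ℂ] H) : Prop where
  selfAdjoint : IsSelfAdjoint (A 1)
  holomorphic : IsHolomorphic.{u, v} (halved A)

/-- The harmonic function `H_A(X) = Re (½ I ⊗ A₀ + ∑_{k ≥ 1} ∑_{|α| = k} X_α ⊗ A_α)`. -/
def harmonicFn {n : ℕ} {X H : Type*} [NormedAddCommGroup X] [InnerProductSpace ℂ X]
    [NormedAddCommGroup H] [InnerProductSpace ℂ H]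
    (A : FreeMonoid (Fin n) → H →L[ℂ] H) (T : Fin n → X →L[ℂ] X) :
    HilbertTensor X H →L[ℂ] HilbertTensor X H :=
  (ℜ (eval (halved A) T) : HilbertTensor X H →L[ℂ] HilbertTensor X H)

/-- The operator `∑_{|α| = k} C_α* C_α`. -/
def columnGram {n : ℕ} {H : Type*} [NormedAddCommGroup H] [InnerProductSpace ℂ H]
    [CompleteSpace H] (C : FreeMonoid (Fin n) → H →L[ℂ] H) (k : ℕ) : H →L[ℂ] H :=
  ∑ α ∈ words n k, ContinuousLinearMap.adjoint (C α) * C α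

end NCHarmonic

end

/-!
Let `S₁, …, Sₙ` be the left creation operators `e_β ↦ e_{gᵢ β}`; they are isometries with
orthogonal ranges, so `r S` lies in the open row ball for `0 ≤ r < 1`. The matrix of `F(r S)` in
the basis `(e_α)` is multi-Toeplitz: its `(α δ, δ)` entry is `r^|α| C_α`, where `C` denotes the
coefficients of `F`, and all other entries vanish. Testing `H_A(r S) ≤ H_B(r S)` on the vectors
`e₁ ⊗ h + ∑_{|β| = k} e_β ⊗ f_β` and letting `r → 1` therefore gives, with `D = B - A` and `D_k`
the column of the `D_β` with `|β| = k`,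
`0 ≤ ⟪h, D₍₀₎ h⟫ + 2 Re ⟪f, D_k h⟫ + ∑_β ⟪f_β, D₍₀₎ f_β⟫`.
For `f = t D_k h` the right-hand side is at most a quadratic polynomial in `t`, whose discriminant
gives `‖D_k h‖² ≤ ‖D₍₀₎‖ ⟪h, D₍₀₎ h⟫`. In particular `‖D_k‖ ≤ ‖D₍₀₎‖`, so that
`‖A_k‖ ≤ ‖D₍₀₎‖ + ‖B_k‖`; the Bohr inequality sums this against `r^k`, and `1/3` is the radius at
which `∑_{k ≥ 1} r^k = r / (1 - r)` reaches `1/2`.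
-/

namespace NCHarmonic

open Filter Topology
open scoped TensorProduct ComplexStarModule InnerProductSpace

theorem isStarProjection_sum_mul_star {ι R : Type*} [Fintype ι] [DecidableEq ι] [Ring R]
    [StarRing R] {a : ι → R} (h : ∀ i j, star (a i) * a j = if i = j then 1 else 0) :
    IsStarProjection (∑ i, a i * star (a i)) where
  isIdempotentElem := by
    simp only [IsIdempotentElem, Finset.sum_mul_sum, mul_assoc, ← mul_assoc (star _) (a _), h,
      ite_mul, one_mul, zero_mul, mul_ite, mul_zero, Finset.sum_ite_eq, Finset.mem_univ, if_true]
  isSelfAdjoint := isSelfAdjoint_sum _ fun i _ => IsSelfAdjoint.mul_star_self (a i)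

theorem exists_norm_succ_sub_le {F : Type*} [SeminormedAddCommGroup F] {P : ℕ → F} {L : F}
    (hP : Tendsto P atTop (𝓝 L)) : ∃ M, ∀ k, ‖P (k + 1) - P k‖ ≤ M := by
  obtain ⟨M, hM⟩ := ((hP.comp (tendsto_add_atTop_nat 1)).sub hP).norm.bddAbove_range
  exact ⟨M, fun k => hM (Set.mem_range_self k)⟩

theorem le_mul_of_forall_quadratic_nonneg {s c d : ℝ} (hs : 0 ≤ s) (hc : 0 ≤ c)
    (h : ∀ t : ℝ, 0 ≤ d + 2 * t * s + c * (t ^ 2 * s)) : s ≤ c * d := by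
  rcases eq_or_lt_of_le hs with rfl | hs
  · have hd : 0 ≤ d := by simpa using h 0
    exact mul_nonneg hc hd
  · have hdiscrim := discrim_le_zero (a := c * s) (b := 2 * s) (c := d)
      fun t => (h t).trans_eq (by ring)
    rw [discrim] at hdiscrim
    refine le_of_mul_le_mul_left ?_ hs
    linarith

section Operators

variable {E : Type*} [NormedAddCommGroup E] [InnerProductSpace ℂ E]

theorem re_inner_realPart_apply [CompleteSpace E] (a : E →L[ℂ] E) (x : E) :
    (⟪x, (ℜ a : E →L[ℂ] E) x⟫_ℂ).re = (⟪x, a x⟫_ℂ).re := by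
  have hstar : (⟪x, star a x⟫_ℂ).re = (⟪x, a x⟫_ℂ).re := by
    rw [ContinuousLinearMap.star_eq_adjoint, ContinuousLinearMap.adjoint_inner_right]
    exact inner_re_symm (𝕜 := ℂ) _ _
  rw [realPart_apply_coe, smul_apply, add_apply, inner_smul_right_eq_smul, inner_add_right,
    Complex.smul_re, Complex.add_re, hstar, smul_eq_mul]
  ring

theorem re_inner_apply_le (T : E →L[ℂ] E) (x : E) : (⟪x, T x⟫_ℂ).re ≤ ‖T‖ * ‖x‖ ^ 2 :=
  calc (⟪x, T x⟫_ℂ).re ≤ ‖x‖ * ‖T x‖ := re_inner_le_norm (𝕜 := ℂ) x (T x)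
    _ ≤ ‖x‖ * (‖T‖ * ‖x‖) := mul_le_mul_of_nonneg_left (T.le_opNorm x) (norm_nonneg x)
    _ = ‖T‖ * ‖x‖ ^ 2 := by ring

theorem inner_eq_of_tendsto_of_eventually {P : ℕ → E →L[ℂ] E} {L : E →L[ℂ] E}
    (hP : Tendsto P atTop (𝓝 L)) {x y : E} {z : ℂ} (h : ∀ᶠ N in atTop, ⟪x, P N y⟫_ℂ = z) :
    ⟪x, L y⟫_ℂ = z :=
  tendsto_nhds_unique
    (tendsto_const_nhds.inner (((ContinuousLinearMap.apply ℂ E y).continuous.tendsto L).comp hP))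
    (tendsto_const_nhds.congr' (h.mono fun _ hN => hN.symm))

end Operators

section Column

variable {ι H K : Type*} [NormedAddCommGroup H] [InnerProductSpace ℂ H] [NormedAddCommGroup K]
  [InnerProductSpace ℂ K]

/-- The column operator `h ↦ (C i h)ᵢ` into the Hilbert direct sum of copies of `K`. -/
noncomputable def column (C : ι → H →L[ℂ] K) : H →L[ℂ] PiLp 2 fun _ : ι => K :=
  (PiLp.continuousLinearEquiv 2 ℂ fun _ : ι => K).symm ∘L ContinuousLinearMap.pi C

theorem column_apply (C : ι → H →L[ℂ] K) (h : H) (i : ι) : column C h i = C i h := rfl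

theorem adjoint_column_comp_self [Fintype ι] [CompleteSpace H] [CompleteSpace K]
    (C : ι → H →L[ℂ] K) :
    ContinuousLinearMap.adjoint (column C) ∘L column C =
      ∑ i, ContinuousLinearMap.adjoint (C i) ∘L C i := by
  ext h
  refine ext_inner_left ℂ fun g => ?_
  simp only [ContinuousLinearMap.comp_apply, ContinuousLinearMap.adjoint_inner_right,
    PiLp.inner_apply, column_apply, sum_apply, inner_sum]

end Column

section WordColumn

variable {n : ℕ} {H : Type*} [NormedAddCommGroup H] [InnerProductSpace ℂ H]

/-- The column `(C_α)_{|α| = k}` of the coefficients of degree `k`. -/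
noncomputable def wordColumn (C : FreeMonoid (Fin n) → H →L[ℂ] H) (k : ℕ) :
    H →L[ℂ] PiLp 2 fun _ : words n k => H :=
  column fun α : words n k => C α

theorem wordColumn_sub (C D : FreeMonoid (Fin n) → H →L[ℂ] H) (k : ℕ) :
    wordColumn (C - D) k = wordColumn C k - wordColumn D k := rfl

theorem columnGram_eq_adjoint_comp [CompleteSpace H] (C : FreeMonoid (Fin n) → H →L[ℂ] H) (k : ℕ) :
    columnGram C k = ContinuousLinearMap.adjoint (wordColumn C k) ∘L wordColumn C k := by
  rw [wordColumn, adjoint_column_comp_self, columnGram, ← Finset.sum_coe_sort]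
  rfl

theorem sqrt_norm_columnGram [CompleteSpace H] (C : FreeMonoid (Fin n) → H →L[ℂ] H) (k : ℕ) :
    √‖columnGram C k‖ = ‖wordColumn C k‖ := by
  rw [columnGram_eq_adjoint_comp, ContinuousLinearMap.norm_adjoint_comp_self,
    Real.sqrt_mul_self (norm_nonneg _)]

theorem re_inner_columnGram [CompleteSpace H] (C : FreeMonoid (Fin n) → H →L[ℂ] H) (k : ℕ)
    (h : H) : (⟪h, columnGram C k h⟫_ℂ).re = ‖wordColumn C k h‖ ^ 2 := by
  rw [columnGram_eq_adjoint_comp, ContinuousLinearMap.comp_apply,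
    ContinuousLinearMap.adjoint_inner_right]
  exact inner_self_eq_norm_sq (𝕜 := ℂ) _

theorem isSelfAdjoint_columnGram [CompleteSpace H] (C : FreeMonoid (Fin n) → H →L[ℂ] H) (k : ℕ) :
    IsSelfAdjoint (columnGram C k) :=
  isSelfAdjoint_sum _ fun α _ => IsSelfAdjoint.star_mul_self (C α)

end WordColumn

section Creation

variable {n : ℕ} {X : Type*} [NormedAddCommGroup X] [InnerProductSpace ℂ X]

theorem monomial_smul (c : ℂ) (T : Fin n → X →L[ℂ] X) (α : FreeMonoid (Fin n)) :
    monomial (c • T) α = c ^ α.length • monomial T α := by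
  induction α using FreeMonoid.inductionOn' with
  | one => simp [monomial]
  | of_mul i α ih =>
    simp only [monomial, map_mul, FreeMonoid.lift_eval_of, FreeMonoid.length_mul,
      FreeMonoid.length_of, pow_add, pow_one, Pi.smul_apply] at ih ⊢
    rw [ih, smul_mul_smul_comm]

theorem smul_mem_rowBall [CompleteSpace X] {c : ℂ} {T : Fin n → X →L[ℂ] X} (hc : ‖c‖ < 1)
    (hT : ‖∑ i, T i * star (T i)‖ ≤ 1) : c • T ∈ rowBall n X := by
  have hsum : ∑ i, (c • T) i * star ((c • T) i) = (c * star c) • ∑ i, T i * star (T i) := by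
    simp only [Pi.smul_apply, star_smul, smul_mul_smul_comm, Finset.smul_sum]
  change ‖∑ i, (c • T) i * star ((c • T) i)‖ < 1
  rw [hsum, norm_smul, norm_mul, norm_star]
  exact (mul_le_of_le_one_right (by positivity) hT).trans_lt
    (mul_lt_one_of_nonneg_of_lt_one_left (norm_nonneg c) hc hc.le)

variable [CompleteSpace X] (e : HilbertBasis (FreeMonoid (Fin n)) ℂ X)

/-- The `i`-th left creation operator `e_β ↦ e_{g_i β}` of an orthonormal basis indexed by words;
for the canonical basis of the full Fock space these are the universal row isometry. -/
noncomputable def creation (i : Fin n) : X →L[ℂ] X :=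
  let hshift := e.orthonormal.comp (FreeMonoid.of i * ·) (mul_right_injective _)
  (hshift.orthogonalFamily.linearIsometry.comp e.repr.toLinearIsometry).toContinuousLinearMap

theorem creation_apply_basis (i : Fin n) (β : FreeMonoid (Fin n)) :
    creation e i (e β) = e (FreeMonoid.of i * β) := by
  classical
  simp [creation, e.repr_self, OrthogonalFamily.linearIsometry_apply_single]

theorem monomial_creation_apply_basis (α β : FreeMonoid (Fin n)) :
    monomial (creation e) α (e β) = e (α * β) := by
  induction α using FreeMonoid.inductionOn' with
  | one => simp [monomial]
  | of_mul i α ih =>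
    simp only [monomial, map_mul, FreeMonoid.lift_eval_of, mul_apply_eq_comp] at ih ⊢
    rw [ih, creation_apply_basis, mul_assoc]

theorem star_creation_mul_creation (i j : Fin n) :
    star (creation e i) * creation e j = if i = j then 1 else 0 := by
  classical
  refine ContinuousLinearMap.ext_on
    (Submodule.dense_iff_topologicalClosure_eq_top.2 e.dense_span) ?_
  rintro _ ⟨β, rfl⟩
  refine e.repr.injective (lp.ext (funext fun γ => ?_))
  have hij : FreeMonoid.of i * γ = FreeMonoid.of j * β ↔ i = j ∧ γ = β := by
    rw [← FreeMonoid.toList.apply_eq_iff_eq, FreeMonoid.toList_of_mul, FreeMonoid.toList_of_mul,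
      List.cons_eq_cons, FreeMonoid.toList.apply_eq_iff_eq]
  rw [e.repr_apply_apply, e.repr_apply_apply, mul_apply_eq_comp,
    ContinuousLinearMap.star_eq_adjoint, ContinuousLinearMap.adjoint_inner_right,
    creation_apply_basis, creation_apply_basis, orthonormal_iff_ite.1 e.orthonormal]
  by_cases h : i = j <;> simp [h, hij, orthonormal_iff_ite.1 e.orthonormal]

theorem ofReal_smul_creation_mem_rowBall {r : ℝ} (hr : r ∈ Set.Ico (0 : ℝ) 1) :
    (r : ℂ) • creation e ∈ rowBall n X :=
  smul_mem_rowBall (by rw [Complex.norm_real, Real.norm_of_nonneg hr.1]; exact hr.2)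
    (isStarProjection_sum_mul_star (star_creation_mul_creation e)).norm_le

end Creation

/-- The elementary tensor `x ⊗ h` in the Hilbert space tensor product. -/
noncomputable def hilbertTmul {X H : Type*} [NormedAddCommGroup X] [InnerProductSpace ℂ X]
    [NormedAddCommGroup H] [InnerProductSpace ℂ H] (x : X) (h : H) : HilbertTensor X H :=
  ((x ⊗ₜ[ℂ] h : X ⊗[ℂ] H) : HilbertTensor X H)

local infixl:100 " ⊗ₕ " => hilbertTmul

section HilbertTensor

variable {X H : Type*} [NormedAddCommGroup X] [InnerProductSpace ℂ X] [NormedAddCommGroup H]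
  [InnerProductSpace ℂ H]

theorem opTensor_hilbertTmul (S : X →L[ℂ] X) (A : H →L[ℂ] H) (x : X) (h : H) :
    opTensor S A (x ⊗ₕ h) = S x ⊗ₕ A h :=
  opTensor_coe_tmul S A x h

theorem smul_hilbertTmul (c : ℂ) (x : X) (h : H) : (c • x) ⊗ₕ h = c • x ⊗ₕ h := by
  rw [hilbertTmul, ← TensorProduct.smul_tmul', UniformSpace.Completion.coe_smul, hilbertTmul]

theorem inner_hilbertTmul (x y : X) (g h : H) :
    ⟪x ⊗ₕ g, y ⊗ₕ h⟫_ℂ = ⟪x, y⟫_ℂ * ⟪g, h⟫_ℂ := by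
  rw [hilbertTmul, hilbertTmul, UniformSpace.Completion.inner_coe, TensorProduct.inner_tmul]

theorem norm_hilbertTmul (x : X) (h : H) : ‖x ⊗ₕ h‖ = ‖x‖ * ‖h‖ := by
  rw [hilbertTmul, UniformSpace.Completion.norm_coe, TensorProduct.norm_tmul]

variable {ι : Type*} {v : ι → X} {s : Finset ι}

/-- The vector `∑_{i ∈ s} v i ⊗ f i`. -/
noncomputable def tensorSum (v : ι → X) (f : PiLp 2 fun _ : s => H) : HilbertTensor X H :=
  ∑ i : s, v i ⊗ₕ f i

open Classical in
theorem inner_hilbertTmul_of_orthonormal (hv : Orthonormal ℂ v) (i j : ι) (g h : H) :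
    ⟪v i ⊗ₕ g, v j ⊗ₕ h⟫_ℂ = if i = j then ⟪g, h⟫_ℂ else 0 := by
  rw [inner_hilbertTmul, orthonormal_iff_ite.1 hv, ite_mul, one_mul, zero_mul]

theorem norm_tensorSum (hv : Orthonormal ℂ v) (f : PiLp 2 fun _ : s => H) :
    ‖tensorSum v f‖ = ‖f‖ := by
  classical
  rw [norm_eq_sqrt_re_inner (𝕜 := ℂ), norm_eq_sqrt_re_inner (𝕜 := ℂ) f, PiLp.inner_apply]
  simp only [tensorSum, sum_inner, inner_sum, inner_hilbertTmul_of_orthonormal hv,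
    Subtype.coe_inj, Finset.sum_ite_eq', Finset.mem_univ, if_true]

end HilbertTensor

section Toeplitz

variable {n : ℕ} {X H : Type*} [NormedAddCommGroup X] [InnerProductSpace ℂ X] [CompleteSpace X]
  [NormedAddCommGroup H] [InnerProductSpace ℂ H] (e : HilbertBasis (FreeMonoid (Fin n)) ℂ X)
  (C : FreeMonoid (Fin n) → H →L[ℂ] H) (c : ℂ)

theorem partialSum_smul_creation_apply (N : ℕ) (δ : FreeMonoid (Fin n)) (h : H) :
    partialSum C (c • creation e) N (e δ ⊗ₕ h) =
      ∑ k ∈ Finset.range N, c ^ k • ∑ α ∈ words n k, e (α * δ) ⊗ₕ C α h := by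
  simp only [partialSum, sum_apply, Finset.smul_sum]
  refine Finset.sum_congr rfl fun k _ => Finset.sum_congr rfl fun α hα => ?_
  rw [opTensor_hilbertTmul, monomial_smul, smul_apply, monomial_creation_apply_basis,
    smul_hilbertTmul, mem_words.1 hα]

theorem partialSum_succ_sub_apply_vacuum (k : ℕ) (h : H) :
    (partialSum C (c • creation e) (k + 1) - partialSum C (c • creation e) k) (e 1 ⊗ₕ h) =
      c ^ k • tensorSum e (wordColumn C k h) := by
  rw [sub_apply, partialSum_smul_creation_apply, partialSum_smul_creation_apply,
    Finset.sum_range_succ_sub_sum, tensorSum, ← Finset.sum_coe_sort]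
  simp only [mul_one, wordColumn, column_apply]

theorem norm_wordColumn_le_div {k : ℕ} {M : ℝ} (hc : c ≠ 0)
    (hM : ‖partialSum C (c • creation e) (k + 1) - partialSum C (c • creation e) k‖ ≤ M) :
    ‖wordColumn C k‖ ≤ M / ‖c‖ ^ k := by
  have hck : 0 < ‖c‖ ^ k := pow_pos (norm_pos_iff.2 hc) k
  refine ContinuousLinearMap.opNorm_le_bound _
    (div_nonneg ((ContinuousLinearMap.opNorm_nonneg _).trans hM) hck.le) fun h => ?_
  rw [div_mul_eq_mul_div, le_div_iff₀' hck]
  calc ‖c‖ ^ k * ‖wordColumn C k h‖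
      = ‖(partialSum C (c • creation e) (k + 1) - partialSum C (c • creation e) k)
          (e 1 ⊗ₕ h)‖ := by
        rw [partialSum_succ_sub_apply_vacuum, norm_smul, norm_tensorSum e.orthonormal, norm_pow]
    _ ≤ M * ‖e 1 ⊗ₕ h‖ := ContinuousLinearMap.le_of_opNorm_le _ hM _
    _ = M * ‖h‖ := by rw [norm_hilbertTmul, e.orthonormal.1, one_mul]

variable {e C c} {L : HilbertTensor X H →L[ℂ] HilbertTensor X H}
  (hL : Tendsto (partialSum C (c • creation e)) atTop (𝓝 L))
include hL

theorem inner_basis_mul_apply (α δ : FreeMonoid (Fin n)) (g h : H) :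
    ⟪e (α * δ) ⊗ₕ g, L (e δ ⊗ₕ h)⟫_ℂ = c ^ α.length * ⟪g, C α h⟫_ℂ := by
  classical
  refine inner_eq_of_tendsto_of_eventually hL ?_
  filter_upwards [eventually_gt_atTop α.length] with N hN
  simp only [partialSum_smul_creation_apply, inner_sum, inner_smul_right,
    inner_hilbertTmul_of_orthonormal e.orthonormal, mul_left_inj, Finset.sum_ite_eq, mem_words,
    mul_ite, mul_zero]
  exact if_pos (Finset.mem_range.2 hN)

theorem inner_basis_apply_eq_zero {γ δ : FreeMonoid (Fin n)} (hγ : ∀ α, γ ≠ α * δ) (g h : H) :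
    ⟪e γ ⊗ₕ g, L (e δ ⊗ₕ h)⟫_ℂ = 0 := by
  classical
  refine inner_eq_of_tendsto_of_eventually hL (.of_forall fun N => ?_)
  simp only [partialSum_smul_creation_apply, inner_sum, inner_smul_right,
    inner_hilbertTmul_of_orthonormal e.orthonormal, hγ, if_false, Finset.sum_const_zero, mul_zero]

theorem inner_tensorSum_apply_vacuum {k : ℕ} (f : PiLp 2 fun _ : words n k => H) (h : H) :
    ⟪tensorSum e f, L (e 1 ⊗ₕ h)⟫_ℂ = c ^ k * ⟪f, wordColumn C k h⟫_ℂ := by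
  rw [tensorSum, sum_inner, PiLp.inner_apply, Finset.mul_sum]
  refine Finset.sum_congr rfl fun β _ => ?_
  have hβ := inner_basis_mul_apply hL β 1 (f β) h
  rwa [mul_one, mem_words.1 β.2] at hβ

theorem inner_vacuum_apply_tensorSum {k : ℕ} (hk : 1 ≤ k) (h : H)
    (f : PiLp 2 fun _ : words n k => H) : ⟪e 1 ⊗ₕ h, L (tensorSum e f)⟫_ℂ = 0 := by
  rw [tensorSum, map_sum, inner_sum]
  refine Finset.sum_eq_zero fun β _ => inner_basis_apply_eq_zero hL (fun α hα => ?_) h (f β)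
  have hlen := congrArg FreeMonoid.length hα
  rw [FreeMonoid.length_mul, mem_words.1 β.2, FreeMonoid.length_one] at hlen
  omega

theorem inner_tensorSum_apply_tensorSum {k : ℕ} (f : PiLp 2 fun _ : words n k => H) :
    ⟪tensorSum e f, L (tensorSum e f)⟫_ℂ = ∑ β, ⟪f β, C 1 (f β)⟫_ℂ := by
  simp only [tensorSum, map_sum, sum_inner, inner_sum]
  refine Finset.sum_congr rfl fun β _ => (Finset.sum_eq_single β (fun δ _ hδ => ?_) ?_).trans ?_
  · refine inner_basis_apply_eq_zero hL (fun α hα => hδ ?_) _ _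
    have hlen := congrArg FreeMonoid.length hα
    rw [FreeMonoid.length_mul, mem_words.1 β.2, mem_words.1 δ.2, right_eq_add,
      FreeMonoid.length_eq_zero] at hlen
    rw [hlen, one_mul] at hα
    exact Subtype.ext hα
  · exact fun hβ => (hβ (Finset.mem_univ β)).elim
  · simpa using inner_basis_mul_apply hL 1 β (f β) (f β)

theorem inner_vacuum_add_tensorSum {k : ℕ} (hk : 1 ≤ k) (h : H)
    (f : PiLp 2 fun _ : words n k => H) :
    ⟪e 1 ⊗ₕ h + tensorSum e f, L (e 1 ⊗ₕ h + tensorSum e f)⟫_ℂ =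
      ⟪h, C 1 h⟫_ℂ + c ^ k * ⟪f, wordColumn C k h⟫_ℂ + ∑ β, ⟪f β, C 1 (f β)⟫_ℂ := by
  have hvacuum : ⟪e 1 ⊗ₕ h, L (e 1 ⊗ₕ h)⟫_ℂ = ⟪h, C 1 h⟫_ℂ := by
    simpa using inner_basis_mul_apply hL 1 1 h h
  rw [map_add, inner_add_left, inner_add_right, inner_add_right, hvacuum,
    inner_vacuum_apply_tensorSum hL hk, inner_tensorSum_apply_vacuum hL,
    inner_tensorSum_apply_tensorSum hL, add_zero, add_assoc]

end Toeplitz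

section BlockNonneg

variable {n : ℕ} {H : Type*} [NormedAddCommGroup H] [InnerProductSpace ℂ H]
  {C : FreeMonoid (Fin n) → H →L[ℂ] H} {k : ℕ}

/-- The multi-Toeplitz block operator with diagonal blocks `C₁` and `C₁ ⊗ I` and lower left block
twice the column of degree `k` has nonnegative real part. -/
def BlockNonneg (C : FreeMonoid (Fin n) → H →L[ℂ] H) (k : ℕ) : Prop :=
  ∀ (h : H) (f : PiLp 2 fun _ : words n k => H),
    0 ≤ (⟪h, C 1 h⟫_ℂ).re + 2 * (⟪f, wordColumn C k h⟫_ℂ).re + ∑ β, (⟪f β, C 1 (f β)⟫_ℂ).re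

theorem sum_re_inner_apply_le {ι : Type*} [Fintype ι] (T : H →L[ℂ] H)
    (f : PiLp 2 fun _ : ι => H) : ∑ i, (⟪f i, T (f i)⟫_ℂ).re ≤ ‖T‖ * ‖f‖ ^ 2 := by
  rw [PiLp.norm_sq_eq_of_L2, Finset.mul_sum]
  exact Finset.sum_le_sum fun i _ => re_inner_apply_le T (f i)

theorem BlockNonneg.norm_wordColumn_apply_sq_le (hC : BlockNonneg C k) (h : H) :
    ‖wordColumn C k h‖ ^ 2 ≤ ‖C 1‖ * (⟪h, C 1 h⟫_ℂ).re := by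
  refine le_mul_of_forall_quadratic_nonneg (sq_nonneg _) (norm_nonneg _) fun t => ?_
  have hnonneg := hC h ((t : ℂ) • wordColumn C k h)
  have hcross : (⟪(t : ℂ) • wordColumn C k h, wordColumn C k h⟫_ℂ).re
      = t * ‖wordColumn C k h‖ ^ 2 := by
    rw [inner_smul_left, Complex.conj_ofReal, Complex.re_ofReal_mul]
    exact congrArg (t * ·) (inner_self_eq_norm_sq (𝕜 := ℂ) _)
  have hdiag := sum_re_inner_apply_le (C 1) ((t : ℂ) • wordColumn C k h)
  rw [norm_smul, mul_pow, Complex.norm_real, Real.norm_eq_abs, sq_abs] at hdiag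
  rw [hcross] at hnonneg
  linarith

theorem BlockNonneg.norm_wordColumn_le (hC : BlockNonneg C k) : ‖wordColumn C k‖ ≤ ‖C 1‖ := by
  refine ContinuousLinearMap.opNorm_le_bound _ (norm_nonneg _) fun h => ?_
  refine le_of_sq_le_sq ?_ (by positivity)
  calc ‖wordColumn C k h‖ ^ 2 ≤ ‖C 1‖ * (⟪h, C 1 h⟫_ℂ).re := hC.norm_wordColumn_apply_sq_le h
    _ ≤ ‖C 1‖ * (‖C 1‖ * ‖h‖ ^ 2) :=
      mul_le_mul_of_nonneg_left (re_inner_apply_le (C 1) h) (norm_nonneg _)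
    _ = (‖C 1‖ * ‖h‖) ^ 2 := by ring

theorem BlockNonneg.columnGram_le [CompleteSpace H] (hC : BlockNonneg C k)
    (h1 : IsSelfAdjoint (C 1)) : columnGram C k ≤ (‖C 1‖ : ℂ) • C 1 := by
  rw [ContinuousLinearMap.le_def, ContinuousLinearMap.isPositive_def']
  refine ⟨(IsSelfAdjoint.smul (Complex.conj_ofReal _) h1).sub (isSelfAdjoint_columnGram C k),
    fun h => ?_⟩
  rw [ContinuousLinearMap.reApplyInnerSelf_apply, inner_re_symm, sub_apply, inner_sub_right,
    smul_apply, inner_smul_right, RCLike.re_to_complex, Complex.sub_re, Complex.re_ofReal_mul,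
    re_inner_columnGram, sub_nonneg]
  exact hC.norm_wordColumn_apply_sq_le h

end BlockNonneg

section Harmonic

variable {n : ℕ} {X H : Type*} [NormedAddCommGroup X] [InnerProductSpace ℂ X] [NormedAddCommGroup H]
  [InnerProductSpace ℂ H]

/-- The series `∑ₖ ∑_{|α| = k} (r T)_α ⊗ C_α` converges in the operator norm for `0 ≤ r < 1`. -/
def RadiallyConvergent (C : FreeMonoid (Fin n) → H →L[ℂ] H) (T : Fin n → X →L[ℂ] X) : Prop :=
  ∀ r ∈ Set.Ico (0 : ℝ) 1, ∃ L, Tendsto (partialSum C ((r : ℂ) • T)) atTop (𝓝 L)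

theorem RadiallyConvergent.tendsto_eval {C : FreeMonoid (Fin n) → H →L[ℂ] H}
    {T : Fin n → X →L[ℂ] X} {r : ℝ} (hC : RadiallyConvergent C T) (hr : r ∈ Set.Ico (0 : ℝ) 1) :
    Tendsto (partialSum C ((r : ℂ) • T)) atTop (𝓝 (eval C ((r : ℂ) • T))) :=
  tendsto_nhds_limUnder (hC r hr)

theorem halved_one (C : FreeMonoid (Fin n) → H →L[ℂ] H) : halved C 1 = (1 / 2 : ℂ) • C 1 :=
  if_pos FreeMonoid.length_one

theorem wordColumn_halved (C : FreeMonoid (Fin n) → H →L[ℂ] H) {k : ℕ} (hk : 1 ≤ k) :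
    wordColumn (halved C) k = wordColumn C k := by
  refine congrArg column (funext fun α => if_neg ?_)
  rw [mem_words.1 α.2]
  omega

variable [CompleteSpace X] {e : HilbertBasis (FreeMonoid (Fin n)) ℂ X}
  {A B C : FreeMonoid (Fin n) → H →L[ℂ] H} {r : ℝ}

theorem RadiallyConvergent.exists_norm_wordColumn_le (hC : RadiallyConvergent C (creation e))
    (h0 : 0 < r) (h1 : r < 1) : ∃ M, ∀ k, ‖wordColumn C k‖ ≤ M / r ^ k := by
  obtain ⟨M, hM⟩ := exists_norm_succ_sub_le
    (F := HilbertTensor X H →L[ℂ] HilbertTensor X H) (hC.tendsto_eval ⟨h0.le, h1⟩)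
  refine ⟨M, fun k => ?_⟩
  simpa only [Complex.norm_real, Real.norm_of_nonneg h0.le] using
    norm_wordColumn_le_div e C (r : ℂ) (Complex.ofReal_ne_zero.2 h0.ne') (hM k)

theorem RadiallyConvergent.summable_norm_wordColumn (hC : RadiallyConvergent C (creation e))
    (h0 : 0 ≤ r) (h1 : r < 1) : Summable fun k => r ^ k * ‖wordColumn C k‖ := by
  obtain ⟨s, hrs, hs⟩ := exists_between h1
  have hs0 : 0 < s := h0.trans_lt hrs
  obtain ⟨M, hM⟩ := hC.exists_norm_wordColumn_le hs0 hs
  refine .of_nonneg_of_le (fun k => by positivity) (fun k => ?_)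
    ((summable_geometric_of_lt_one (div_nonneg h0 hs0.le) ((div_lt_one hs0).2 hrs)).mul_right M)
  calc r ^ k * ‖wordColumn C k‖ ≤ r ^ k * (M / s ^ k) :=
        mul_le_mul_of_nonneg_left (hM k) (pow_nonneg h0 k)
    _ = (r / s) ^ k * M := by rw [div_pow, mul_div_assoc', div_mul_eq_mul_div]

theorem RadiallyConvergent.summable_sqrt_norm_columnGram [CompleteSpace H]
    (hA : RadiallyConvergent (halved A) (creation e)) (h0 : 0 ≤ r) (h1 : r < 1) :
    Summable fun k => r ^ (k + 1) * √‖columnGram A (k + 1)‖ := by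
  refine ((summable_nat_add_iff 1).2 (hA.summable_norm_wordColumn h0 h1)).congr fun k => ?_
  rw [sqrt_norm_columnGram, wordColumn_halved A (Nat.le_add_left 1 k)]

theorem re_inner_harmonicFn (hA : RadiallyConvergent (halved A) (creation e))
    (hr : r ∈ Set.Ico (0 : ℝ) 1) {k : ℕ} (hk : 1 ≤ k) (h : H) (f : PiLp 2 fun _ : words n k => H) :
    (⟪e 1 ⊗ₕ h + tensorSum e f,
      harmonicFn A ((r : ℂ) • creation e) (e 1 ⊗ₕ h + tensorSum e f)⟫_ℂ).re =
      1 / 2 * (⟪h, A 1 h⟫_ℂ).re + r ^ k * (⟪f, wordColumn A k h⟫_ℂ).re +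
        1 / 2 * ∑ β, (⟪f β, A 1 (f β)⟫_ℂ).re := by
  have hhalf (z : ℂ) : (1 / 2 * z).re = 1 / 2 * z.re := by simp
  rw [harmonicFn, re_inner_realPart_apply,
    inner_vacuum_add_tensorSum (hA.tendsto_eval hr) hk, wordColumn_halved A hk]
  simp only [halved_one, smul_apply, inner_smul_right, ← Finset.mul_sum]
  rw [Complex.add_re, Complex.add_re, hhalf, hhalf, ← Complex.ofReal_pow, Complex.re_ofReal_mul,
    Complex.re_sum]

theorem blockNonneg_sub_of_harmonicFn_le (hA : RadiallyConvergent (halved A) (creation e))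
    (hB : RadiallyConvergent (halved B) (creation e))
    (hAB : ∀ r ∈ Set.Ico (0 : ℝ) 1,
      harmonicFn A ((r : ℂ) • creation e) ≤ harmonicFn B ((r : ℂ) • creation e))
    {k : ℕ} (hk : 1 ≤ k) : BlockNonneg (B - A) k := by
  intro h f
  let q : ℝ → ℝ := fun r => (⟪h, (B - A) 1 h⟫_ℂ).re
    + 2 * r ^ k * (⟪f, wordColumn (B - A) k h⟫_ℂ).re + ∑ β, (⟪f β, (B - A) 1 (f β)⟫_ℂ).re
  have hq : ∀ r ∈ Set.Ico (0 : ℝ) 1, 0 ≤ q r := by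
    intro r hr
    have hpos := (ContinuousLinearMap.le_def _ _).1 (hAB r hr)
      |>.re_inner_nonneg_right (e 1 ⊗ₕ h + tensorSum e f)
    rw [sub_apply, inner_sub_right, RCLike.re_to_complex, Complex.sub_re,
      re_inner_harmonicFn hA hr hk, re_inner_harmonicFn hB hr hk] at hpos
    simp only [q, wordColumn_sub, Pi.sub_apply, sub_apply, inner_sub_right, Complex.sub_re,
      Finset.sum_sub_distrib]
    linarith
  have hlim : Tendsto q (𝓝[<] 1) (𝓝 (q 1)) :=
    (Continuous.tendsto (by fun_prop) 1).mono_left nhdsWithin_le_nhds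
  have hq_one : 0 ≤ q 1 :=
    ge_of_tendsto hlim (Filter.mem_of_superset (Ico_mem_nhdsLT zero_lt_one) hq)
  simpa only [q, one_pow, mul_one] using hq_one

end Harmonic

theorem tsum_pow_succ_mul_le {a b : ℕ → ℝ} {r d : ℝ} (h0 : 0 ≤ r) (h1 : r < 1)
    (hab : ∀ k, a k ≤ d + b k) (ha : Summable fun k => r ^ (k + 1) * a k)
    (hb : Summable fun k => r ^ (k + 1) * b k) :
    ∑' k, r ^ (k + 1) * a k ≤ r / (1 - r) * d + ∑' k, r ^ (k + 1) * b k := by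
  have hgeom : HasSum (fun k => r ^ (k + 1) * d) (r / (1 - r) * d) := by
    simpa only [pow_succ', div_eq_mul_inv] using
      ((hasSum_geometric_of_lt_one h0 h1).mul_left r).mul_right d
  rw [← hgeom.tsum_eq, ← hgeom.summable.tsum_add hb]
  refine ha.tsum_le_tsum (fun k => ?_) (hgeom.summable.add hb)
  rw [← mul_add]
  exact mul_le_mul_of_nonneg_left (hab k) (pow_nonneg h0 _)

theorem div_one_sub_le_half {r : ℝ} (hr : r ≤ 1 / 3) : r / (1 - r) ≤ 1 / 2 := by
  rw [div_le_div_iff₀ (by linarith) two_pos]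
  linarith

/-- The full Fock space on `n` generators, as the `ℓ²` space over all words; the words are lifted
to the universe in which harmonic functions are evaluated. -/
abbrev Fock (n : ℕ) : Type v := lp (fun _ : ULift.{v} (FreeMonoid (Fin n)) => ℂ) 2

/-- The canonical orthonormal basis `(e_α)` of the full Fock space. -/
noncomputable def fockBasis (n : ℕ) : HilbertBasis (FreeMonoid (Fin n)) ℂ (Fock.{v} n) :=
  let b : HilbertBasis (ULift.{v} (FreeMonoid (Fin n))) ℂ (Fock.{v} n) :=
    .ofRepr (.refl ℂ _)
  .mk (b.orthonormal.comp ULift.up ULift.up_injective) <| by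
    rw [ULift.up_surjective.range_comp, b.dense_span]

theorem IsHolomorphic.radiallyConvergent {n : ℕ} {H : Type u} {X : Type v} [NormedAddCommGroup H]
    [InnerProductSpace ℂ H] [NormedAddCommGroup X] [InnerProductSpace ℂ X] [CompleteSpace X]
    {C : FreeMonoid (Fin n) → H →L[ℂ] H} (hC : IsHolomorphic.{u, v} C)
    (e : HilbertBasis (FreeMonoid (Fin n)) ℂ X) : RadiallyConvergent C (creation e) :=
  fun _ hr => hC X _ (ofReal_smul_creation_mem_rowBall e hr)

end NCHarmonic

open NCHarmonic in
theorem theorem3p1_general {n : ℕ} {X H : Type*} [NormedAddCommGroup X] [InnerProductSpace ℂ X]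
    [CompleteSpace X] [NormedAddCommGroup H] [InnerProductSpace ℂ H] [CompleteSpace H]
    (e : HilbertBasis (FreeMonoid (Fin n)) ℂ X) (A B : FreeMonoid (Fin n) → H →L[ℂ] H)
    (hself : IsSelfAdjoint (B 1 - A 1)) (hA : RadiallyConvergent (halved A) (creation e))
    (hB : RadiallyConvergent (halved B) (creation e))
    (hAB : ∀ r ∈ Set.Ico (0 : ℝ) 1,
      harmonicFn A ((r : ℂ) • creation e) ≤ harmonicFn B ((r : ℂ) • creation e)) :
    (∀ k, 1 ≤ k → columnGram (fun α => B α - A α) k ≤ (‖B 1 - A 1‖ : ℂ) • (B 1 - A 1)) ∧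
    ∀ r : ℝ, 0 ≤ r → r < 1 →
      Summable (fun k => r ^ (k + 1) * √‖columnGram A (k + 1)‖) ∧
      Summable (fun k => r ^ (k + 1) * √‖columnGram B (k + 1)‖) ∧
      ∑' k, r ^ (k + 1) * √‖columnGram A (k + 1)‖
        ≤ r / (1 - r) * ‖B 1 - A 1‖ + ∑' k, r ^ (k + 1) * √‖columnGram B (k + 1)‖ := by
  have hblock {k : ℕ} (hk : 1 ≤ k) : BlockNonneg (B - A) k :=
    blockNonneg_sub_of_harmonicFn_le hA hB hAB hk
  refine ⟨fun k hk => (hblock hk).columnGram_le hself, fun r h0 h1 => ?_⟩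
  have hsA := hA.summable_sqrt_norm_columnGram h0 h1
  have hsB := hB.summable_sqrt_norm_columnGram h0 h1
  refine ⟨hsA, hsB, tsum_pow_succ_mul_le h0 h1 (fun k => ?_) hsA hsB⟩
  rw [sqrt_norm_columnGram, sqrt_norm_columnGram]
  calc ‖wordColumn A (k + 1)‖
      ≤ ‖wordColumn (B - A) (k + 1)‖ + ‖wordColumn B (k + 1)‖ := by
        rw [wordColumn_sub]
        exact (norm_le_insert (wordColumn B (k + 1)) _).trans_eq (add_comm _ _)
    _ ≤ ‖B 1 - A 1‖ + ‖wordColumn B (k + 1)‖ := by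
        gcongr
        exact (hblock (Nat.le_add_left 1 k)).norm_wordColumn_le

theorem theorem3p1 {n : ℕ} {H : Type u} [NormedAddCommGroup H] [InnerProductSpace ℂ H]
    [CompleteSpace H] (A B : FreeMonoid (Fin n) → H →L[ℂ] H)
    (hA : NCHarmonic.IsHarmonicFamily.{u, v} A) (hB : NCHarmonic.IsHarmonicFamily.{u, v} B)
    (hAB : ∀ (X : Type v) [NormedAddCommGroup X] [InnerProductSpace ℂ X] [CompleteSpace X],
      ∀ T ∈ NCHarmonic.rowBall n X, NCHarmonic.harmonicFn A T ≤ NCHarmonic.harmonicFn B T) :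
    (∀ k : ℕ, 1 ≤ k →
      NCHarmonic.columnGram (fun α => B α - A α) k ≤ (‖B 1 - A 1‖ : ℂ) • (B 1 - A 1)) ∧
    (∀ r : ℝ, 0 ≤ r → r ≤ 1 / 3 →
      Summable (fun k : ℕ => r ^ (k + 1) * Real.sqrt ‖NCHarmonic.columnGram A (k + 1)‖) ∧
      Summable (fun k : ℕ => r ^ (k + 1) * Real.sqrt ‖NCHarmonic.columnGram B (k + 1)‖) ∧
      ∑' k : ℕ, r ^ (k + 1) * Real.sqrt ‖NCHarmonic.columnGram A (k + 1)‖
        ≤ 1 / 2 * ‖B 1 - A 1‖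
          + ∑' k : ℕ, r ^ (k + 1) * Real.sqrt ‖NCHarmonic.columnGram B (k + 1)‖) := by
  let e := NCHarmonic.fockBasis.{v} n
  obtain ⟨hgram, hbohr⟩ := theorem3p1_general e A B (hB.selfAdjoint.sub hA.selfAdjoint)
    (hA.holomorphic.radiallyConvergent e) (hB.holomorphic.radiallyConvergent e)
    fun _ hr => hAB _ _ (NCHarmonic.ofReal_smul_creation_mem_rowBall e hr)
  refine ⟨hgram, fun r h0 h3 => (hbohr r h0 (by linarith)).imp_right fun h => ⟨h.1, h.2.trans ?_⟩⟩
  exact add_le_add_left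
    (mul_le_mul_of_nonneg_right (NCHarmonic.div_one_sub_le_half h3) (norm_nonneg _)) _
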